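/- All graphs are finite, simple and undirected. For $k\ge 0$, a set $U$ of vertices of a graph $G$ is $k$-independent if the induced subgraph $G[U]$ has maximum degree at most $k$. The $k$-defective chromatic number $\chi_k(G)$ is the smallest integer $m$ such that the vertices of $G$ can be coloured with $m$ colours so that every colour class is $k$-independent. The graph $G$ is $(m,k)$-critical if $\chi_k(G)=m$ and $\chi_k(G-u)<m$ for every vertex $u$ of $G$. Let $G_5$ be the graph with the 10 vertices $u,v,u_1,u_2,u_3,u_4,u_5,z,z_1,z_2$ and the following 18 edges: $uu_i$ and $vu_i$ for $1\le i\le 5$; $zu_1,\ zu_2,\ zz_1,\ zz_2$; $z_1u_3,\ z_1u_4$; $z_2u_3,\ z_2u_5$. **Theorem.** A graph $G$ of order 10 is triangle-free and $(3,1)$-critical if and only if it is isomorphic to $G_5$. Thus $G_5$ is, up to isomorphism, the unique triangle-free $(3,1)$-critical graph of order 10. -/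

import Mathlib

namespace SimpleGraph

/-- A set `U` of vertices is `k`-independent if the induced subgraph `G[U]` has maximum degree
at most `k`, i.e. every vertex of `G[U]` has at most `k` neighbours in `G[U]`. -/
def IsKIndependent {V : Type*} (G : SimpleGraph V) (k : ℕ) (U : Set V) : Prop :=
  ∀ v : U, ((G.induce U).neighborSet v).encard ≤ k

/-- `G` is `(m, k)`-colourable if its vertices can be coloured with `m` colours such that every
colour class is `k`-independent. -/
def DefectiveColorable {V : Type*} (G : SimpleGraph V) (m k : ℕ) : Prop :=
  ∃ c : V → Fin m, ∀ i : Fin m, G.IsKIndependent k (c ⁻¹' {i})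

/-- The `k`-defective chromatic number `χ_k(G)`: the smallest `m` for which `G` is
`(m, k)`-colourable (`⊤` if there is none, which does not happen for finite graphs). -/
noncomputable def defectiveChromaticNumber {V : Type*} (G : SimpleGraph V) (k : ℕ) : ℕ∞ :=
  ⨅ m ∈ {m : ℕ | G.DefectiveColorable m k}, (m : ℕ∞)

/-- `G` is `(m, k)`-critical if `χ_k(G) = m` and `χ_k(G - u) < m` for every vertex `u`. -/
def IsDefectiveCritical {V : Type*} (G : SimpleGraph V) (m k : ℕ) : Prop :=
  G.defectiveChromaticNumber k = m ∧
    ∀ u : V, (G.induce ({u}ᶜ : Set V)).defectiveChromaticNumber k < m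

/-- The graph `G₅`, with 10 vertices and 18 edges. The vertices are numbered
`u = 0`, `v = 1`, `u₁ = 2`, `u₂ = 3`, `u₃ = 4`, `u₄ = 5`, `u₅ = 6`, `z = 7`, `z₁ = 8`, `z₂ = 9`.
Both `u` and `v` are adjacent to all of `u₁, …, u₅`; `z` is adjacent to `u₁, u₂, z₁, z₂`;
`z₁` is adjacent to `u₃, u₄`; and `z₂` is adjacent to `u₃, u₅`. -/
def graphG5 : SimpleGraph (Fin 10) :=
  SimpleGraph.fromRel fun a b : Fin 10 => (a, b) ∈
    ([(0, 2), (0, 3), (0, 4), (0, 5), (0, 6),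
      (1, 2), (1, 3), (1, 4), (1, 5), (1, 6),
      (7, 2), (7, 3), (7, 8), (7, 9),
      (8, 4), (8, 5),
      (9, 4), (9, 6)] : List (Fin 10 × Fin 10))

end SimpleGraph

namespace DefectiveSearch

/-! Matrices over `Bool` with ten rows are packed into numbers: the entry `(i, j)` is the binary
digit at position `11 * i + j`, and the digits at the positions `11 * i + 10` vanish. The functions
below use recursors, `Nat` literals and accelerated `Nat` operations only, so that the kernel
evaluates them fast. -/

/-! Let `v` have maximum degree `D` in a triangle-free (3,1)-critical graph of order 10. A
2-colouring with fewest monochromatic edges is 1-defective when all degrees are at most 3, so `D ≥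
4`. Colour `N(v)` against the rest: `N(v)` is independent and `v` is isolated in its class, so the
defect must be a path `a, x, b` outside the closed neighbourhood of `v`. Hence `D + 4 ≤ 10`, leaving
`D = 4, 5, 6`.

Number `v` as 0, its neighbours as 1, …, `D` and the path as 8, 9, 7. The order of the neighbours is
free, so they may be sorted by their adjacencies to later vertices. An exhaustive search then
encloses the graph between a lower matrix `L` and an upper matrix `U`. A branch dies if `L` has too
large a degree or a vertex-deleted subgraph with no good colouring, if `U` has a good colouring, or
if sortedness fails; adding an edge removes from `U` the pairs that would close a triangle. Only one
labelled graph survives, and it is isomorphic to `graphG5`. `search_sound` justifies the search,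
`exists_numbering` supplies its hypotheses, and the converse is a finite check on the surviving
graph. -/

def branch (b : Bool) (s t : Bool) : Bool := @Bool.rec (fun _ => Bool) t s b

def conj (a b : Bool) : Bool := @Bool.rec (fun _ => Bool) false b a

def disj (a b : Bool) : Bool := @Bool.rec (fun _ => Bool) b true a

def anyIn (p : ℕ → Bool) (l : List ℕ) : Bool :=
  @List.rec ℕ (fun _ => Bool) false (fun a _ ih => @Bool.rec (fun _ => Bool) ih true (p a)) l

def keep (p : ℕ → Bool) (l : List ℕ) : List ℕ :=
  @List.rec ℕ (fun _ => List ℕ) []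
    (fun a _ ih => @Bool.rec (fun _ => List ℕ) ih (a :: ih) (p a)) l

def isNil (l : List ℕ) : Bool := @List.rec ℕ (fun _ => Bool) true (fun _ _ _ => false) l

def bit (n k : ℕ) : Bool := Nat.beq (Nat.land (Nat.shiftRight n k) 1) 1

/-- The packed matrix with rows `r 0, …, r (k - 1)`. -/
def packRows (r : ℕ → ℕ) (k : ℕ) : ℕ :=
  @Nat.rec (fun _ => ℕ) 0 (fun i ih => Nat.lor ih (Nat.shiftLeft (r i) (Nat.mul 11 i))) k

/-- The number with binary digits `f 0, …, f (k - 1)`. -/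
def packBits (f : ℕ → Bool) (k : ℕ) : ℕ :=
  @Nat.rec (fun _ => ℕ) 0
    (fun i ih => Nat.lor ih (Nat.shiftLeft (@Bool.rec (fun _ => ℕ) 0 1 (f i)) i)) k

def packMatrix (f : ℕ → ℕ → Bool) : ℕ := packRows (fun i => packBits (f i) 10) 10

def row (x i : ℕ) : ℕ := Nat.land (Nat.shiftRight x (Nat.mul 11 i)) 1023

/-- The `j`-th column of a packed matrix, as the first column of a packed matrix. -/
def col (x j : ℕ) : ℕ := Nat.land (Nat.shiftRight x j) 634134936313486520338360567809

/-- Every row of the packed matrix has at most one nonzero entry. -/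
def sparse (x : ℕ) : Bool := Nat.beq (Nat.land x (Nat.add x 648720039848696710306142860868607)) 0

def entry (x i j : ℕ) : Bool := bit x (Nat.add (Nat.mul 11 i) j)

/-- The matrix of the pairs of equally coloured vertices, where the digits of `n` are the
colours. -/
def colourMask (n : ℕ) : ℕ :=
  packRows (fun i => @Bool.rec (fun _ => ℕ) (Nat.sub 1023 n) n (bit n i)) 10

/-- Swapping the two colours does not change the mask, so vertex 9 may be given colour 0 and 512
codes suffice. -/
def colourMasks : List ℕ := (List.range 512).map colourMask

/-- The matrix of the pairs of vertices different from `w`. -/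
def avoidMask (w : ℕ) : ℕ :=
  packMatrix fun i j => conj (Bool.not (Nat.beq i w)) (Bool.not (Nat.beq j w))

def remove (x m : ℕ) : ℕ := Nat.xor x (Nat.land x m)

def edgeBits (i j : ℕ) : ℕ :=
  Nat.lor (Nat.shiftLeft 1 (Nat.add (Nat.mul 11 i) j))
    (Nat.shiftLeft 1 (Nat.add (Nat.mul 11 j) i))

/-- The pairs that would form a triangle with the edge `ij` and another edge of `x`. -/
def triangleBits (x i j : ℕ) : ℕ :=
  Nat.lor
    (Nat.lor (Nat.shiftLeft (col x j) i) (Nat.shiftLeft (col x i) j))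
    (Nat.lor (Nat.shiftLeft (row x j) (Nat.mul 11 i)) (Nat.shiftLeft (row x i) (Nat.mul 11 j)))

def clearLowest (x : ℕ) : ℕ := Nat.land x (Nat.pred x)

/-- The number `x` has more than `n` nonzero binary digits. -/
def moreBits (n x : ℕ) : Bool :=
  Nat.blt 0 (@Nat.rec (fun _ => ℕ) x (fun _ ih => clearLowest ih) n)

/-- No colouring is good for the graph with the vertex `w` deleted. -/
def deletionBad (L w : ℕ) : Bool :=
  Bool.not (anyIn (fun M => sparse (Nat.land (Nat.land L M) (avoidMask w)))
    (keep (fun M => entry M w (@Bool.rec (fun _ => ℕ) 9 8 (Nat.beq w 9))) colourMasks))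

/-- The first disjunct only affects speed: it tries vertices of small degree in `L` before all the
others. -/
def someDeletionBad (L : ℕ) : Bool :=
  disj (anyIn (fun w => conj (Bool.not (moreBits 2 (row L w))) (deletionBad L w)) (List.range 10))
    (anyIn (fun w => deletionBad L w) (List.range 10))

/-- Row `i + 1` is already, by its edges in `L`, larger than row `i` can become within `U`. -/
def unsorted (D L U : ℕ) : Bool :=
  anyIn (fun i => Nat.blt (Nat.shiftRight (row U i) (Nat.add D 1))
      (Nat.shiftRight (row L (Nat.add i 1)) (Nat.add D 1))) (List.range' 1 (D - 1))

/-- A colouring good for `U` is good for `L`, so only `al` needs testing. While `al` is nonempty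
every deletion from `L` is colourable too, so criticality is tested only once `al` is empty. -/
def colourStep (L U : ℕ) (al : List ℕ) (k : ℕ → ℕ → List ℕ → Bool) : Bool :=
  disj (branch (isNil al) (someDeletionBad L) (anyIn (fun M => sparse (Nat.land U M)) al))
    (k L U al)

def addVisit (D i j L U : ℕ) (al : List ℕ) (k : ℕ → ℕ → List ℕ → Bool) : Bool :=
  disj (disj (moreBits D (row L i)) (moreBits D (row L j)))
    (disj (unsorted D L U) (colourStep L U (keep (fun M => sparse (Nat.land L M)) al) k))

/-- `L` is unchanged here, so the degrees, `al` and the deletions need no new test. -/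
def removeVisit (D L U : ℕ) (al : List ℕ) (k : ℕ → ℕ → List ℕ → Bool) : Bool :=
  disj (unsorted D L U) (disj (anyIn (fun M => sparse (Nat.land U M)) al) (k L U al))

/-- Branch on the listed pairs, where `al` holds the masks of the colourings that are still good
for `L`: no graph between `L` and `U` other than `T` survives. -/
def search (D T : ℕ) (es : List (ℕ × ℕ)) : ℕ → ℕ → List ℕ → Bool :=
  @List.rec (ℕ × ℕ) (fun _ => ℕ → ℕ → List ℕ → Bool)
    (fun L U _ => conj (Nat.beq L T) (Nat.beq U T))
    (fun e _ ih L U al =>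
      branch (disj (entry L e.1 e.2) (Bool.not (entry U e.1 e.2))) (ih L U al)
        (conj
          (addVisit D e.1 e.2 (Nat.lor L (edgeBits e.1 e.2)) (remove U (triangleBits L e.1 e.2))
            al ih)
          (removeVisit D L (remove U (edgeBits e.1 e.2)) al ih))) es

/-- The star at vertex 0 and the path 7, 9, 8. -/
def isFixedEdge (D i j : ℕ) : Bool :=
  (i == 0 && 0 < j && j ≤ D) || (j == 0 && 0 < i && i ≤ D) ||
    (i == 9 && (j == 7 || j == 8)) || (j == 9 && (i == 7 || i == 8))

/-- Two neighbours of vertex 0 are nonadjacent, and so are 7 and 8, which share the neighbour 9. -/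
def isFreePair (D i j : ℕ) : Bool :=
  0 < i && 0 < j && (D < i || D < j) && !(i == j) && !(7 ≤ i && 7 ≤ j)

def lowerInit (D : ℕ) : ℕ := packMatrix (isFixedEdge D)

def upperInit (D : ℕ) : ℕ := packMatrix fun i j => isFixedEdge D i j || isFreePair D i j

/-- The columns run downwards from 9, so the leading digits of the sorted codes are decided first
and `unsorted` takes effect early. -/
def pairOrder (D : ℕ) : List (ℕ × ℕ) :=
  ((List.range' (D + 1) (9 - D)).flatMap fun i =>
      (List.range' (D + 1) (i - (D + 1))).map fun j => (i, j)) ++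
    (List.range' (D + 1) (9 - D)).reverse.flatMap fun b => (List.range' 1 D).map fun i => (i, b)

def searchFrom (D T : ℕ) : Bool :=
  search D T (pairOrder D) (lowerInit D) (upperInit D)
    (keep (fun M => sparse (Nat.land (lowerInit D) M)) colourMasks)

/-! ### Correctness of the digit operations -/

theorem branch_eq (b s t : Bool) : branch b s t = bif b then s else t := by cases b <;> rfl

theorem conj_eq (a b : Bool) : conj a b = (a && b) := by cases a <;> rfl

theorem disj_eq (a b : Bool) : disj a b = (a || b) := by cases a <;> rfl

theorem anyIn_eq (p : ℕ → Bool) (l : List ℕ) : anyIn p l = l.any p := by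
  induction l with
  | nil => rfl
  | cons a l ih =>
    rw [List.any_cons, ← ih]
    change @Bool.rec (fun _ => Bool) (anyIn p l) true (p a) = _
    cases p a <;> rfl

theorem keep_eq (p : ℕ → Bool) (l : List ℕ) : keep p l = l.filter p := by
  induction l with
  | nil => rfl
  | cons a l ih =>
    rw [List.filter_cons, ← ih]
    change @Bool.rec (fun _ => List ℕ) (keep p l) (a :: keep p l) (p a) = _
    cases p a <;> rfl

theorem bit_eq (n k : ℕ) : bit n k = n.testBit k := by
  have h : bit n k = Nat.beq (n >>> k &&& 1) 1 := rfl
  rw [h, Nat.testBit, Nat.and_comm]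
  rcases Nat.mod_two_eq_zero_or_one (n >>> k) with h | h
  · simp [h]; rfl
  · simp [h]

theorem entry_eq (x i j : ℕ) : entry x i j = x.testBit (11 * i + j) := bit_eq _ _

theorem testBit_row {x i j : ℕ} (hj : j < 10) : (row x i).testBit j = x.testBit (11 * i + j) := by
  change (x >>> (11 * i) &&& 1023).testBit j = _
  rw [Nat.testBit_and, Nat.testBit_shiftRight, show 1023 = 2 ^ 10 - 1 from rfl,
    Nat.testBit_two_pow_sub_one]
  simp [hj]

theorem row_lt (x i : ℕ) : row x i < 2 ^ 10 :=
  lt_of_le_of_lt (Nat.and_le_right (n := x >>> (11 * i)) (m := 1023)) (by norm_num)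

theorem testBit_row_eq_false {x i j : ℕ} (hj : 10 ≤ j) : (row x i).testBit j = false :=
  Nat.testBit_lt_two_pow (lt_of_lt_of_le (row_lt x i) (Nat.pow_le_pow_right (by norm_num) hj))

theorem testBit_packBits (f : ℕ → Bool) (k j : ℕ) :
    (packBits f k).testBit j = (decide (j < k) && f j) := by
  induction k with
  | zero => simp [packBits]
  | succ k ih =>
    change (packBits f k ||| (@Bool.rec (fun _ => ℕ) 0 1 (f k)) <<< k).testBit j = _
    rw [Nat.testBit_or, ih, Nat.testBit_shiftLeft]
    rcases lt_trichotomy j k with h | h | h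
    · simp [h, Nat.lt_succ_of_lt h, Nat.not_le.2 h]
    · subst h
      cases f j <;> simp
    · have h1 : ¬ j < k := by omega
      have h2 : ¬ j < k + 1 := by omega
      have h3 : j - k ≠ 0 := by omega
      have h4 : (1 : ℕ).testBit (j - k) = false := by
        rw [← pow_zero 2, Nat.testBit_two_pow]; simp [Ne.symm h3]
      cases f k <;> simp [h1, h2, h4]

theorem testBit_packRows (r : ℕ → ℕ) (hr : ∀ i, r i < 2 ^ 10) (k i j : ℕ) (hj : j < 11) :
    (packRows r k).testBit (11 * i + j) = (decide (i < k) && (r i).testBit j) := by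
  induction k with
  | zero => simp [packRows]
  | succ k ih =>
    change (packRows r k ||| (r k) <<< (11 * k)).testBit _ = _
    rw [Nat.testBit_or, ih, Nat.testBit_shiftLeft]
    rcases lt_trichotomy i k with h | h | h
    · have : ¬ (11 * k ≤ 11 * i + j) := by omega
      simp [h, Nat.lt_succ_of_lt h, this]
    · subst h
      simp
    · have h1 : ¬ i < k := by omega
      have h2 : ¬ i < k + 1 := by omega
      have h3 : (r k).testBit (11 * i + j - 11 * k) = false :=
        Nat.testBit_lt_two_pow (lt_of_lt_of_le (hr k)
          (Nat.pow_le_pow_right (by norm_num) (by omega)))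
      simp [h1, h2, h3]

theorem packRows_lt (r : ℕ → ℕ) (hr : ∀ i, r i < 2 ^ 10) (k : ℕ) :
    packRows r k < 2 ^ (11 * k) := by
  refine Nat.lt_pow_two_of_testBit _ fun n hn => ?_
  have h := testBit_packRows r hr k (n / 11) (n % 11) (Nat.mod_lt _ (by norm_num))
  rw [Nat.div_add_mod] at h
  have : ¬ n / 11 < k := by omega
  simp [h, this]

theorem packBits_lt (f : ℕ → Bool) (k : ℕ) : packBits f k < 2 ^ k :=
  Nat.lt_pow_two_of_testBit _ fun n hn => by
    rw [testBit_packBits]; simp [Nat.not_lt.2 hn]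

theorem testBit_packMatrix (f : ℕ → ℕ → Bool) {i j : ℕ} (hi : i < 10) (hj : j < 10) :
    (packMatrix f).testBit (11 * i + j) = f i j := by
  rw [packMatrix, testBit_packRows _ (fun i => packBits_lt _ _) _ _ _ (by omega),
    testBit_packBits]
  simp [hi, hj]

theorem testBit_remove (x m n : ℕ) :
    (remove x m).testBit n = (x.testBit n && !m.testBit n) := by
  change (x ^^^ (x &&& m)).testBit n = _
  rw [Nat.testBit_xor, Nat.testBit_and]
  cases x.testBit n <;> cases m.testBit n <;> rfl

theorem testBit_one_shiftLeft (k n : ℕ) : (1 <<< k).testBit n = decide (k = n) := by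
  rw [Nat.one_shiftLeft, Nat.testBit_two_pow]

theorem testBit_edgeBits {i j a b : ℕ} (hj : j < 10) (hi : i < 10) (hb : b < 10) :
    (edgeBits i j).testBit (11 * a + b) = true ↔ (a = i ∧ b = j) ∨ (a = j ∧ b = i) := by
  change (1 <<< (11 * i + j) ||| 1 <<< (11 * j + i)).testBit _ = true ↔ _
  rw [Nat.testBit_or, testBit_one_shiftLeft, testBit_one_shiftLeft, Bool.or_eq_true,
    decide_eq_true_iff, decide_eq_true_iff]
  omega

theorem testBit_col {x j n : ℕ} (h : (col x j).testBit n = true) :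
    ∃ k, n = 11 * k ∧ x.testBit (11 * k + j) = true := by
  have e : 634134936313486520338360567809 = packRows (fun _ => 1) 10 := by decide +kernel
  change (x >>> j &&& 634134936313486520338360567809).testBit n = true at h
  rw [Nat.testBit_and, Nat.testBit_shiftRight, Bool.and_eq_true] at h
  obtain ⟨h1, h2⟩ := h
  have h3 := testBit_packRows (fun _ => 1) (by norm_num) 10 (n / 11) (n % 11)
    (Nat.mod_lt _ (by norm_num))
  rw [Nat.div_add_mod, ← e, h2] at h3
  have h4 : n % 11 = 0 := by
    by_contra h5
    have : (1 : ℕ).testBit (n % 11) = false := by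
      rw [← pow_zero 2, Nat.testBit_two_pow]; simp [Ne.symm h5]
    simp [this] at h3
  refine ⟨n / 11, by omega, ?_⟩
  rwa [show 11 * (n / 11) + j = j + n by omega]

/-- The constant in `sparse`, for a matrix with `n` rows. -/
def sparseOffset : ℕ → ℕ
  | 0 => 0
  | n + 1 => 1023 + 2048 * sparseOffset n

theorem and_add_eq_zero_iff : ∀ r < 1024, (r &&& (r + 1023) = 0 ↔
    r = 0 ∨ ∃ k < 10, r = 2 ^ k) := by
  decide +kernel

theorem sparse_aux (r : ℕ) (hr : r < 1024) : r &&& (r + 1023) = 0 ↔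
    ∀ a < 10, ∀ b < 10, r.testBit a = true → r.testBit b = true → a = b := by
  rw [and_add_eq_zero_iff r hr]
  constructor
  · rintro (rfl | ⟨k, -, rfl⟩) a - b - ha hb
    · simp at ha
    · rw [Nat.testBit_two_pow, decide_eq_true_iff] at ha hb
      exact ha.symm.trans hb
  · intro h
    by_contra! hc
    obtain ⟨a, ha⟩ := Nat.exists_testBit_of_ne_zero hc.1
    have lt : ∀ {c}, r.testBit c = true → c < 10 := fun {c} hc => by
      by_contra! h10
      have := Nat.testBit_lt_two_pow (lt_of_lt_of_le (show r < 2 ^ 10 from hr)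
        (Nat.pow_le_pow_right (by norm_num) h10))
      simp [this] at hc
    refine hc.2 a (lt ha) (Nat.eq_of_testBit_eq fun b => ?_)
    rw [Nat.testBit_two_pow, Bool.eq_iff_iff, decide_eq_true_iff]
    exact ⟨fun hb => h a (lt ha) b (lt hb) ha hb, fun hb => hb ▸ ha⟩

/-- For a row `r > 0` the sum `r + 1023` is `1024 + (r - 1)`, and `r &&& (r - 1)` clears the lowest
digit of `r`. The empty guard column absorbs the 1024, so all rows are tested by one addition. -/
theorem and_sparseOffset_eq_zero_iff (n x : ℕ) (hx : x < 2 ^ (11 * n))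
    (hg : ∀ i, x.testBit (11 * i + 10) = false) :
    x &&& (x + sparseOffset n) = 0 ↔ ∀ i < n, ∀ a < 10, ∀ b < 10,
      x.testBit (11 * i + a) = true → x.testBit (11 * i + b) = true → a = b := by
  induction n generalizing x with
  | zero => simp_all
  | succ n ih =>
    have hmod : x % 2 ^ 11 < 1024 := by
      refine Nat.lt_pow_two_of_testBit (n := 10) _ fun i hi => ?_
      rw [Nat.testBit_mod_two_pow]
      rcases hi.eq_or_lt with rfl | hi
      · simpa using hg 0
      · simp; omega
    have hdiv := ih (x / 2 ^ 11)
      (Nat.div_lt_of_lt_mul (by rw [← pow_add]; convert hx using 2; ring))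
      (fun i => by
        rw [Nat.testBit_div_two_pow, show 11 * i + 10 + 11 = 11 * (i + 1) + 10 by ring]
        exact hg _)
    have hsum : x + sparseOffset (n + 1) =
        2 ^ 11 * (x / 2 ^ 11 + sparseOffset n) + (x % 2 ^ 11 + 1023) := by
      rw [sparseOffset]; omega
    -- The lowest row contributes at most `1023 + 1023 < 2 ^ 11`, so nothing is carried into the
    -- next row.
    have hq : (x + sparseOffset (n + 1)) / 2 ^ 11 = x / 2 ^ 11 + sparseOffset n := by
      rw [hsum]; omega
    have hm : (x + sparseOffset (n + 1)) % 2 ^ 11 = x % 2 ^ 11 + 1023 := by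
      rw [hsum]; omega
    have key : x &&& (x + sparseOffset (n + 1)) = 0 ↔
        (x % 2 ^ 11) &&& (x % 2 ^ 11 + 1023) = 0 ∧
          (x / 2 ^ 11) &&& (x / 2 ^ 11 + sparseOffset n) = 0 := by
      rw [← hq, ← hm, ← Nat.and_mod_two_pow, ← Nat.and_div_two_pow]
      omega
    rw [key, sparse_aux _ hmod, hdiv]
    have e1 : ∀ a < 10, (x % 2 ^ 11).testBit a = x.testBit (11 * 0 + a) := fun a ha => by
      rw [Nat.testBit_mod_two_pow]; simp; omega
    have e2 : ∀ i a, (x / 2 ^ 11).testBit (11 * i + a) = x.testBit (11 * (i + 1) + a) :=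
      fun i a => by rw [Nat.testBit_div_two_pow]; congr 1; ring
    simp only [e2]
    constructor
    · rintro ⟨h1, h2⟩ (_ | i) hi a ha b hb
      · rw [← e1 a ha, ← e1 b hb]; exact h1 a ha b hb
      · exact h2 i (by omega) a ha b hb
    · intro h
      refine ⟨fun a ha b hb => ?_, fun i hi => h (i + 1) (by omega)⟩
      rw [e1 a ha, e1 b hb]; exact h 0 (by omega) a ha b hb

theorem sparse_iff {x : ℕ} (hx : x < 2 ^ 110) (hg : ∀ i, x.testBit (11 * i + 10) = false) :
    sparse x = true ↔ ∀ i < 10, ∀ a < 10, ∀ b < 10,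
      x.testBit (11 * i + a) = true → x.testBit (11 * i + b) = true → a = b := by
  rw [← and_sparseOffset_eq_zero_iff 10 x hx hg]
  rw [show sparseOffset 10 = 648720039848696710306142860868607 by decide +kernel]
  exact Iff.of_eq Nat.beq_eq

theorem colourMask_row_lt (n : ℕ) (hn : n < 2 ^ 10) (i : ℕ) :
    @Bool.rec (fun _ => ℕ) (Nat.sub 1023 n) n (bit n i) < 2 ^ 10 := by
  cases bit n i
  · exact lt_of_le_of_lt (Nat.sub_le 1023 n) (by norm_num)
  · exact hn

theorem testBit_colourMask {n i j : ℕ} (hn : n < 2 ^ 10) (hi : i < 10) (hj : j < 10) :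
    (colourMask n).testBit (11 * i + j) = (n.testBit i == n.testBit j) := by
  rw [colourMask, testBit_packRows _ (colourMask_row_lt n hn) _ _ _ (by omega), bit_eq]
  cases n.testBit i
  · change (_ && (1023 - n).testBit j) = _
    have := Nat.testBit_two_pow_sub_succ hn j
    rw [show 2 ^ 10 - (n + 1) = 1023 - n by omega] at this
    rw [this]
    cases n.testBit j <;> simp [hi, hj]
  · cases n.testBit j <;> simp_all

theorem colourMask_lt {n : ℕ} (hn : n < 2 ^ 10) : colourMask n < 2 ^ 110 :=
  packRows_lt _ (colourMask_row_lt n hn) 10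

theorem testBit_colourMask_guard {n : ℕ} (hn : n < 2 ^ 10) (i : ℕ) :
    (colourMask n).testBit (11 * i + 10) = false := by
  rw [colourMask, testBit_packRows _ (colourMask_row_lt n hn) _ _ _ (by omega),
    Nat.testBit_lt_two_pow (colourMask_row_lt n hn i), Bool.and_false]

theorem sparse_and_colourMask {n : ℕ} (hn : n < 2 ^ 10) (x : ℕ) :
    sparse (Nat.land x (colourMask n)) = true ↔ ∀ i < 10, ∀ a < 10, ∀ b < 10,
      x.testBit (11 * i + a) = true → n.testBit a = n.testBit i →
        x.testBit (11 * i + b) = true → n.testBit b = n.testBit i → a = b := by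
  change sparse (x &&& colourMask n) = true ↔ _
  rw [sparse_iff (lt_of_le_of_lt Nat.and_le_right (colourMask_lt hn))
    fun i => by rw [Nat.testBit_and, testBit_colourMask_guard hn, Bool.and_false]]
  refine forall₂_congr fun i hi => forall₂_congr fun a ha => forall₂_congr fun b hb => ?_
  rw [Nat.testBit_and, Nat.testBit_and, testBit_colourMask hn hi ha, testBit_colourMask hn hi hb]
  simp only [Bool.and_eq_true, beq_iff_eq]
  grind

theorem mem_colourMasks {M : ℕ} : M ∈ colourMasks ↔ ∃ n < 512, colourMask n = M := by
  simp [colourMasks]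

theorem testBit_of_clearLowest {x j : ℕ} (h : (clearLowest x).testBit j = true) :
    x.testBit j = true := by
  change (x &&& (x - 1)).testBit j = true at h
  rw [Nat.testBit_and, Bool.and_eq_true] at h
  exact h.1

theorem exists_testBit_not_clearLowest {x : ℕ} (h : 0 < x) :
    ∃ j, x.testBit j = true ∧ (clearLowest x).testBit j = false := by
  by_contra! hc
  have h1 : x ≤ clearLowest x :=
    Nat.le_of_testBit fun j hj => by simpa using hc j hj
  have h2 : clearLowest x ≤ x - 1 := Nat.and_le_right (n := x)
  omega

theorem exists_testBits_of_moreBits {n x : ℕ} (h : moreBits n x = true) :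
    ∃ s : Finset ℕ, s.card = n + 1 ∧ ∀ j ∈ s, x.testBit j = true := by
  have pos : 0 < @Nat.rec (fun _ => ℕ) x (fun _ ih => clearLowest ih) n :=
    (Iff.of_eq Nat.blt_eq).1 h
  -- Going back through the clearings, each step recovers a digit that had been cleared and so is
  -- not yet in `s`.
  have key : ∀ (m : ℕ) (s : Finset ℕ), 0 < @Nat.rec (fun _ => ℕ) x (fun _ ih => clearLowest ih) m →
      (∀ j ∈ s, (@Nat.rec (fun _ => ℕ) x (fun _ ih => clearLowest ih) m).testBit j = true) →
      ∃ t : Finset ℕ, t.card = s.card + m ∧ ∀ j ∈ t, x.testBit j = true := by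
    intro m
    induction m with
    | zero => exact fun s _ hs => ⟨s, rfl, hs⟩
    | succ m ih =>
      intro s hpos hs
      set y : ℕ := @Nat.rec (fun _ => ℕ) x (fun _ ih => clearLowest ih) m with hy
      change 0 < clearLowest y at hpos
      change ∀ j ∈ s, (clearLowest y).testBit j = true at hs
      have hy0 : 0 < y := lt_of_lt_of_le hpos (Nat.and_le_left (m := y - 1))
      obtain ⟨j, hj1, hj2⟩ := exists_testBit_not_clearLowest hy0
      have hjs : j ∉ s := fun hj => by simp [hs j hj] at hj2
      obtain ⟨t, ht1, ht2⟩ := ih (insert j s) hy0 fun i hi => by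
        rcases Finset.mem_insert.1 hi with rfl | hi
        · exact hj1
        · exact testBit_of_clearLowest (hs i hi)
      refine ⟨t, ?_, ht2⟩
      rw [ht1, Finset.card_insert_of_notMem hjs]
      ring
  obtain ⟨j, hj⟩ := Nat.exists_testBit_of_ne_zero pos.ne'
  obtain ⟨t, ht1, ht2⟩ := key n {j} pos (by simpa using hj)
  exact ⟨t, by rw [ht1, Finset.card_singleton, add_comm], ht2⟩

/-! ### Admissible relations and soundness of the search -/

/-- The colouring `c` of the vertices satisfying `P` is `1`-defective for the relation `R`. -/
def GoodOn (R : ℕ → ℕ → Bool) (P : ℕ → Prop) (c : ℕ → Bool) : Prop :=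
  ∀ i a b, P i → P a → P b → R i a = true → R i b = true → c a = c i → c b = c i → a = b

/-- The properties of the sought triangle-free critical graphs on `{0, …, 9}` that the search
uses; the rows with numbers `1, …, D`, cut off at the columns after `D`, are sorted. -/
structure Admissible (D : ℕ) (R : ℕ → ℕ → Bool) : Prop where
  symm : ∀ i j, R i j = true → R j i = true
  lt : ∀ i j, R i j = true → i < 10
  triangle : ∀ i j k, R i j = true → R j k = true → R i k = false
  degree : ∀ i (s : Finset ℕ), (∀ j ∈ s, R i j = true) → s.card ≤ D
  sorted : ∀ i, 1 ≤ i → i < D →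
    packBits (R (i + 1)) 10 >>> (D + 1) ≤ packBits (R i) 10 >>> (D + 1)
  not_good : ∀ c, ¬ GoodOn R (fun _ => True) c
  critical : ∀ w < 10, ∃ c, GoodOn R (· ≠ w) c

/-- All edges of the packed matrix `L` are edges of `R`. -/
def Lower (L : ℕ) (R : ℕ → ℕ → Bool) : Prop :=
  ∀ i < 10, ∀ j < 10, L.testBit (11 * i + j) = true → R i j = true

/-- All edges of `R` are edges of the packed matrix `U`. -/
def Upper (U : ℕ) (R : ℕ → ℕ → Bool) : Prop :=
  ∀ i < 10, ∀ j < 10, R i j = true → U.testBit (11 * i + j) = true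

variable {D : ℕ} {R : ℕ → ℕ → Bool} {L U : ℕ}

theorem Admissible.lt_right (h : Admissible D R) {i j : ℕ} (hij : R i j = true) : j < 10 :=
  h.lt j i (h.symm i j hij)

theorem testBit_xor_code (c : ℕ → Bool) {i : ℕ} (hi : i < 10) :
    (packBits (fun k => c k ^^ c 9) 9).testBit i = (c i ^^ c 9) := by
  rw [testBit_packBits]
  rcases (Nat.lt_succ_iff.1 hi).lt_or_eq with h | rfl <;> simp_all

theorem packBits_nine_lt (f : ℕ → Bool) : packBits f 9 < 2 ^ 10 :=
  (packBits_lt f 9).trans (by norm_num)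

theorem deletionBad_eq_false (h : Admissible D R) (hL : Lower L R) {w : ℕ} (hw : w < 10) :
    deletionBad L w = false := by
  obtain ⟨c, hc⟩ := h.critical w hw
  set r : ℕ := @Bool.rec (fun _ => ℕ) 9 8 (Nat.beq w 9) with hr
  have hr' : r < 10 ∧ r ≠ w := by
    by_cases h9 : w = 9
    · subst h9; exact ⟨by decide, by decide⟩
    · have : Nat.beq w 9 = false := Bool.eq_false_iff.2 fun e => h9 (Nat.eq_of_beq_eq_true e)
      rw [hr, this]
      exact ⟨by decide, Ne.symm h9⟩
  -- The colour of `w` is irrelevant after its deletion; giving it the colour of `r` makes the mask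
  -- pass the filter in `deletionBad`.
  set c' := Function.update c w (c r) with hc'
  have hcw : ∀ i, i ≠ w → c' i = c i := fun i hi => Function.update_of_ne hi _ _
  set n := packBits (fun k => c' k ^^ c' 9) 9 with hn
  have hn9 : n < 2 ^ 9 := packBits_lt _ 9
  have hn10 : n < 2 ^ 10 := packBits_nine_lt _
  rw [deletionBad, anyIn_eq, keep_eq, Bool.not_eq_false', List.any_eq_true]
  refine ⟨colourMask n, List.mem_filter.2 ⟨mem_colourMasks.2 ⟨n, hn9, rfl⟩, ?_⟩, ?_⟩
  · rw [entry_eq, testBit_colourMask hn10 hw hr'.1, beq_iff_eq, testBit_xor_code _ hw,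
      testBit_xor_code _ hr'.1, hcw r hr'.2, hc', Function.update_self]
  · have e : Nat.land (Nat.land L (colourMask n)) (avoidMask w) =
        Nat.land (L &&& avoidMask w) (colourMask n) := Nat.and_right_comm _ _ _
    rw [e, sparse_and_colourMask hn10]
    have av : ∀ i < 10, ∀ j < 10, (L &&& avoidMask w).testBit (11 * i + j) = true →
        R i j = true ∧ i ≠ w ∧ j ≠ w := by
      intro i hi j hj hij
      rw [Nat.testBit_and, Bool.and_eq_true, avoidMask, testBit_packMatrix _ hi hj, conj_eq,
        Bool.and_eq_true, Bool.not_eq_true', Bool.not_eq_true'] at hij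
      exact ⟨hL i hi j hj hij.1, Nat.ne_of_beq_eq_false hij.2.1, Nat.ne_of_beq_eq_false hij.2.2⟩
    intro i hi a ha b hb h1 h2 h3 h4
    obtain ⟨r1, iw, aw⟩ := av i hi a ha h1
    obtain ⟨r2, -, bw⟩ := av i hi b hb h3
    rw [testBit_xor_code _ ha, testBit_xor_code _ hi, hcw a aw, hcw i iw] at h2
    rw [testBit_xor_code _ hb, testBit_xor_code _ hi, hcw b bw, hcw i iw] at h4
    exact hc i a b iw aw bw r1 r2 (Bool.xor_left_inj.1 h2) (Bool.xor_left_inj.1 h4)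

theorem someDeletionBad_eq_false (h : Admissible D R) (hL : Lower L R) :
    someDeletionBad L = false := by
  rw [someDeletionBad, disj_eq, anyIn_eq, anyIn_eq, Bool.or_eq_false_iff, List.any_eq_false,
    List.any_eq_false]
  refine ⟨fun w hw => ?_, fun w hw => ?_⟩ <;>
    simp [conj_eq, deletionBad_eq_false h hL (List.mem_range.1 hw)]

theorem sparse_eq_false_of_upper (h : Admissible D R) (hU : Upper U R) {n : ℕ} (hn : n < 512) :
    sparse (Nat.land U (colourMask n)) = false := by
  by_contra hs
  rw [Bool.not_eq_false, sparse_and_colourMask (hn.trans (by norm_num))] at hs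
  refine h.not_good n.testBit fun i a b _ _ _ ha hb hca hcb => ?_
  have hi := h.lt i a ha
  exact hs i hi a (h.lt_right ha) b (h.lt_right hb) (hU i hi a (h.lt_right ha) ha) hca
    (hU i hi b (h.lt_right hb) hb) hcb

theorem anyIn_sparse_eq_false (h : Admissible D R) (hU : Upper U R) {al : List ℕ}
    (hal : ∀ M ∈ al, M ∈ colourMasks) : anyIn (fun M => sparse (Nat.land U M)) al = false := by
  rw [anyIn_eq, List.any_eq_false]
  intro M hM
  obtain ⟨n, hn, rfl⟩ := mem_colourMasks.1 (hal M hM)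
  exact Bool.not_eq_true _ ▸ sparse_eq_false_of_upper h hU hn

theorem moreBits_row_eq_false (h : Admissible D R) (hL : Lower L R) {i : ℕ} (hi : i < 10) :
    moreBits D (row L i) = false := by
  by_contra hm
  obtain ⟨s, hs, hb⟩ := exists_testBits_of_moreBits (Bool.eq_true_of_not_eq_false hm)
  have := h.degree i s fun j hj => by
    have hj10 : j < 10 := by
      by_contra! hge
      exact Bool.false_ne_true ((testBit_row_eq_false hge).symm.trans (hb j hj))
    have := hb j hj
    rw [testBit_row hj10] at this
    exact hL i hi j hj10 this
  omega

theorem row_le_code (hL : Lower L R) {i : ℕ} (hi : i < 10) (k : ℕ) :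
    row L i >>> k ≤ packBits (R i) 10 >>> k := by
  refine Nat.le_of_testBit fun j hj => ?_
  rw [Nat.testBit_shiftRight] at hj ⊢
  by_cases hk : k + j < 10
  · rw [testBit_row hk] at hj
    simp [testBit_packBits, hk, hL i hi _ hk hj]
  · simp [testBit_row_eq_false (Nat.le_of_not_lt hk)] at hj

theorem code_le_row (hU : Upper U R) {i : ℕ} (hi : i < 10) (k : ℕ) :
    packBits (R i) 10 >>> k ≤ row U i >>> k := by
  refine Nat.le_of_testBit fun j hj => ?_
  rw [Nat.testBit_shiftRight] at hj ⊢
  rw [testBit_packBits, Bool.and_eq_true, decide_eq_true_iff] at hj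
  rw [testBit_row hj.1]
  exact hU i hi _ hj.1 hj.2

/-- Fewer digits give a smaller number, so the code of a row of `R` lies between those of `L` and
`U`. -/
theorem unsorted_eq_false (hD : D < 10) (h : Admissible D R) (hL : Lower L R) (hU : Upper U R) :
    unsorted D L U = false := by
  rw [unsorted, anyIn_eq, List.any_eq_false]
  intro i hi
  rw [List.mem_range'_1] at hi
  rw [Nat.blt_eq, not_lt]
  exact (row_le_code hL (i := i + 1) (by omega) (D + 1)).trans
    ((h.sorted i (by omega) (by omega)).trans (code_le_row hU (by omega) (D + 1)))

theorem Lower.add_edge (h : Admissible D R) (hL : Lower L R) {i j : ℕ} (hi : i < 10) (hj : j < 10)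
    (hij : R i j = true) : Lower (Nat.lor L (edgeBits i j)) R := by
  intro a ha b hb hab
  change (L ||| edgeBits i j).testBit _ = true at hab
  rw [Nat.testBit_or, Bool.or_eq_true, testBit_edgeBits hj hi hb] at hab
  rcases hab with hab | ⟨rfl, rfl⟩ | ⟨rfl, rfl⟩
  · exact hL a ha b hb hab
  · exact hij
  · exact h.symm _ _ hij

theorem Upper.remove (hU : Upper U R) {m : ℕ}
    (hm : ∀ a < 10, ∀ b < 10, R a b = true → m.testBit (11 * a + b) = false) :
    Upper (remove U m) R := by
  intro a ha b hb hab
  rw [testBit_remove, hU a ha b hb hab, hm a ha b hb hab]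
  rfl

theorem Upper.remove_edge (h : Admissible D R) (hU : Upper U R) {i j : ℕ} (hi : i < 10)
    (hj : j < 10) (hij : R i j = false) : Upper (DefectiveSearch.remove U (edgeBits i j)) R := by
  refine hU.remove fun a ha b hb hab => ?_
  by_contra hc
  rw [Bool.not_eq_false, testBit_edgeBits hj hi hb] at hc
  rcases hc with ⟨rfl, rfl⟩ | ⟨rfl, rfl⟩
  · simp [hij] at hab
  · simp [h.symm _ _ hab] at hij

/-- The digits of the shifted column are pairs `(k, i)` with `k` adjacent to `j` in `L`; such an
edge would form a triangle with `ij`. -/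
theorem col_shiftLeft_eq_false (h : Admissible D R) (hL : Lower L R) {i j a b : ℕ} (hi : i < 10)
    (hj : j < 10) (hij : R i j = true) (ha : a < 10) (hb : b < 10) (hab : R a b = true) :
    (col L j <<< i).testBit (11 * a + b) = false := by
  by_contra hc
  rw [Bool.not_eq_false, Nat.testBit_shiftLeft, Bool.and_eq_true, decide_eq_true_iff] at hc
  obtain ⟨k, hk1, hk2⟩ := testBit_col hc.2
  have hka : k = a := by omega
  have hbi : b = i := by omega
  subst hka hbi
  have := h.triangle _ _ _ hab hij
  rw [hL _ ha _ hj hk2] at this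
  exact absurd this (by decide)

theorem row_shiftLeft_eq_false (h : Admissible D R) (hL : Lower L R) {i j a b : ℕ}
    (hj : j < 10) (hij : R i j = true) (hb : b < 10) (hab : R a b = true) :
    (row L j <<< (11 * i)).testBit (11 * a + b) = false := by
  by_contra hc
  rw [Bool.not_eq_false, Nat.testBit_shiftLeft, Bool.and_eq_true, decide_eq_true_iff] at hc
  have hlt : 11 * a + b - 11 * i < 10 := by
    by_contra! hge
    simp [testBit_row_eq_false hge] at hc
  have hai : a = i := by omega
  subst hai
  rw [testBit_row hlt, show 11 * a + b - 11 * a = b by omega] at hc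
  have := h.triangle _ _ _ hij (hL _ hj _ hb hc.2)
  simp [hab] at this

theorem Upper.remove_triangleBits (h : Admissible D R) (hL : Lower L R) (hU : Upper U R)
    {i j : ℕ} (hi : i < 10) (hj : j < 10) (hij : R i j = true) :
    Upper (DefectiveSearch.remove U (triangleBits L i j)) R := by
  refine hU.remove fun a ha b hb hab => ?_
  have hji := h.symm _ _ hij
  change ((col L j <<< i ||| col L i <<< j) |||
    (row L j <<< (11 * i) ||| row L i <<< (11 * j))).testBit _ = false
  rw [Nat.testBit_or, Nat.testBit_or, Nat.testBit_or,
    col_shiftLeft_eq_false h hL hi hj hij ha hb hab,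
    col_shiftLeft_eq_false h hL hj hi hji ha hb hab,
    row_shiftLeft_eq_false h hL hj hij hb hab, row_shiftLeft_eq_false h hL hi hji hb hab]
  rfl

/-- What the search claims: the relation `R` is the packed matrix `T`. -/
def IsPacked (T : ℕ) (R : ℕ → ℕ → Bool) : Prop :=
  ∀ i < 10, ∀ j < 10, R i j = T.testBit (11 * i + j)

/-- At each pair the branch that agrees with `R` keeps `R` between `L` and `U`. There every pruning
test is false, so the truth of the search passes to the recursive call. Of `al` only membership in
`colourMasks` matters; its filtering is for speed. -/
theorem search_sound (hD : D < 10) (h : Admissible D R) (T : ℕ) (es : List (ℕ × ℕ)) :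
    (∀ e ∈ es, e.1 < 10 ∧ e.2 < 10) → ∀ (L U : ℕ) (al : List ℕ), (∀ M ∈ al, M ∈ colourMasks) →
      Lower L R → Upper U R → search D T es L U al = true → IsPacked T R := by
  induction es with
  | nil =>
    intro _ L U al _ hL hU hs
    change conj (Nat.beq L T) (Nat.beq U T) = true at hs
    rw [conj_eq, Bool.and_eq_true, Nat.beq_eq, Nat.beq_eq] at hs
    obtain ⟨rfl, rfl⟩ := hs
    exact fun i hi j hj => Bool.eq_iff_iff.2 ⟨hU i hi j hj, hL i hi j hj⟩
  | cons e es ih =>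
    intro he L U al hal hL hU hs
    have ih' := ih fun e he' => he e (List.mem_cons_of_mem _ he')
    obtain ⟨hi, hj⟩ := he e List.mem_cons_self
    change branch _ (search D T es L U al) (conj
      (addVisit D e.1 e.2 (Nat.lor L (edgeBits e.1 e.2)) (remove U (triangleBits L e.1 e.2))
        al (search D T es))
      (removeVisit D L (remove U (edgeBits e.1 e.2)) al (search D T es))) = true at hs
    rw [branch_eq] at hs
    cases hb : disj (entry L e.1 e.2) (Bool.not (entry U e.1 e.2)) with
    | true =>
      rw [hb] at hs
      exact ih' L U al hal hL hU hs
    | false =>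
      rw [hb, cond_false, conj_eq, Bool.and_eq_true] at hs
      cases hR : R e.1 e.2 with
      | true =>
        have hs := hs.1
        have hU' := Upper.remove_triangleBits h hL hU hi hj hR
        have hL' := hL.add_edge h hi hj hR
        have hal' : ∀ M ∈ keep (fun M => sparse
            (Nat.land (Nat.lor L (edgeBits e.1 e.2)) M)) al, M ∈ colourMasks := fun M hM => by
          rw [keep_eq] at hM
          exact hal M (List.mem_of_mem_filter hM)
        rw [addVisit, colourStep, disj_eq, disj_eq, disj_eq, disj_eq, branch_eq,
          moreBits_row_eq_false h hL' hi, moreBits_row_eq_false h hL' hj,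
          unsorted_eq_false hD h hL' hU', someDeletionBad_eq_false h hL',
          anyIn_sparse_eq_false h hU' hal', Bool.cond_self] at hs
        exact ih' _ _ _ hal' hL' hU' hs
      | false =>
        have hs := hs.2
        have hU' := Upper.remove_edge h hU hi hj hR
        rw [removeVisit, disj_eq, disj_eq, unsorted_eq_false hD h hL hU',
          anyIn_sparse_eq_false h hU' hal] at hs
        exact ih' _ _ _ hal hL hU' hs

theorem searchFrom_sound (hD : D < 10) (h : Admissible D R) {T : ℕ}
    (fixed : ∀ i < 10, ∀ j < 10, isFixedEdge D i j = true → R i j = true)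
    (free : ∀ i < 10, ∀ j < 10, R i j = true → (isFixedEdge D i j || isFreePair D i j) = true)
    (hs : searchFrom D T = true) : IsPacked T R := by
  refine search_sound hD h T _ ?_ _ _ _ ?_ ?_ ?_ hs
  · simp only [pairOrder, List.mem_append, List.mem_flatMap, List.mem_map, List.mem_range'_1,
      List.mem_reverse]
    rintro e (⟨i, hi, j, hj, rfl⟩ | ⟨i, hi, j, hj, rfl⟩) <;> constructor <;> dsimp only <;> omega
  · intro M hM
    rw [keep_eq] at hM
    exact List.mem_of_mem_filter hM
  · intro i hi j hj hij
    rw [lowerInit, testBit_packMatrix _ hi hj] at hij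
    exact fixed i hi j hj hij
  · intro i hi j hj hij
    rw [upperInit, testBit_packMatrix _ hi hj]
    exact free i hi j hj hij

/-- The adjacency matrix of the graph that the search finds. -/
def foundMatrix : ℕ := 247357834430232279397162313451582

/-- Vertex 0 has degree 5 in `foundMatrix` and degree `D` at every leaf, so for `D = 4` and `D = 6`
success means that all branches die. -/
theorem searchFrom_four : searchFrom 4 foundMatrix = true := by decide +kernel

theorem searchFrom_five : searchFrom 5 foundMatrix = true := by decide +kernel

theorem searchFrom_six : searchFrom 6 foundMatrix = true := by decide +kernel

end DefectiveSearch

namespace SimpleGraph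

/-! ### Criticality in terms of 2-colourings -/

section Colourings

variable {V : Type*} (G : SimpleGraph V)

/-- The `2`-colouring `c` of the vertices satisfying `P` is `1`-defective. -/
def IsGoodOn (P : V → Prop) (c : V → Bool) : Prop :=
  ∀ x a b, P x → P a → P b → G.Adj x a → G.Adj x b → c a = c x → c b = c x → a = b

theorem isKIndependent_one_iff {U : Set V} :
    G.IsKIndependent 1 U ↔ ∀ x ∈ U, ∀ a ∈ U, ∀ b ∈ U, G.Adj x a → G.Adj x b → a = b := by
  simp only [IsKIndependent, Nat.cast_one, Set.encard_le_one_iff, mem_neighborSet, comap_adj,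
    Function.Embedding.subtype_apply, Subtype.forall, Subtype.mk.injEq]

theorem defectiveColorable_one_iff {m : ℕ} :
    G.DefectiveColorable m 1 ↔
      ∃ c : V → Fin m, ∀ x a b, G.Adj x a → G.Adj x b → c a = c x → c b = c x → a = b := by
  refine exists_congr fun c => ?_
  simp only [isKIndependent_one_iff, Set.mem_preimage, Set.mem_singleton_iff]
  exact ⟨fun h x a b h1 h2 h3 h4 => h (c x) x rfl a h3 b h4 h1 h2,
    fun h i x hx a ha b hb h1 h2 => h x a b h1 h2 (ha.trans hx.symm) (hb.trans hx.symm)⟩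

theorem DefectiveColorable.mono {G : SimpleGraph V} {m n : ℕ} (h : G.DefectiveColorable m 1)
    (hmn : m ≤ n) : G.DefectiveColorable n 1 := by
  rw [defectiveColorable_one_iff] at h ⊢
  obtain ⟨c, hc⟩ := h
  exact ⟨fun x => Fin.castLE hmn (c x), fun x a b h1 h2 h3 h4 =>
    hc x a b h1 h2 (Fin.castLE_injective hmn h3) (Fin.castLE_injective hmn h4)⟩

theorem defectiveChromaticNumber_lt_succ_iff {m : ℕ} :
    G.defectiveChromaticNumber 1 < (m + 1 : ℕ) ↔ G.DefectiveColorable m 1 := by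
  simp only [defectiveChromaticNumber, iInf_lt_iff, Set.mem_ofPred_eq, Nat.cast_lt, exists_prop]
  exact ⟨fun ⟨n, hn, hlt⟩ => hn.mono (Nat.lt_succ_iff.1 hlt), fun h => ⟨m, h, Nat.lt_succ_self m⟩⟩

theorem defectiveColorable_two_iff :
    G.DefectiveColorable 2 1 ↔ ∃ c, G.IsGoodOn (fun _ => True) c := by
  rw [defectiveColorable_one_iff]
  constructor
  · rintro ⟨c, hc⟩
    exact ⟨fun x => finTwoEquiv (c x), fun x a b _ _ _ h1 h2 h3 h4 =>
      hc x a b h1 h2 (finTwoEquiv.injective h3) (finTwoEquiv.injective h4)⟩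
  · rintro ⟨c, hc⟩
    exact ⟨fun x => finTwoEquiv.symm (c x), fun x a b h1 h2 h3 h4 =>
      hc x a b trivial trivial trivial h1 h2 (finTwoEquiv.symm.injective h3)
        (finTwoEquiv.symm.injective h4)⟩

theorem defectiveColorable_two_induce_iff (u : V) :
    (G.induce ({u}ᶜ : Set V)).DefectiveColorable 2 1 ↔ ∃ c, G.IsGoodOn (· ≠ u) c := by
  classical
  rw [defectiveColorable_two_iff]
  constructor
  · rintro ⟨c, hc⟩
    refine ⟨fun x => if h : x ≠ u then c ⟨x, h⟩ else true, fun x a b hx ha hb h1 h2 h3 h4 => ?_⟩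
    simp only [dif_pos hx, dif_pos ha, dif_pos hb] at h3 h4
    exact congrArg Subtype.val
      (hc ⟨x, hx⟩ ⟨a, ha⟩ ⟨b, hb⟩ trivial trivial trivial h1 h2 h3 h4)
  · rintro ⟨c, hc⟩
    exact ⟨fun x => c x, fun x a b _ _ _ h1 h2 h3 h4 =>
      Subtype.ext (hc x a b x.2 a.2 b.2 h1 h2 h3 h4)⟩

/-- The vertex `u` alone receives the third colour. -/
theorem defectiveColorable_three_of_isGoodOn {u : V} {c : V → Bool} (hc : G.IsGoodOn (· ≠ u) c) :
    G.DefectiveColorable 3 1 := by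
  classical
  rw [defectiveColorable_one_iff]
  refine ⟨fun x => if x = u then 2 else if c x then 1 else 0, fun x a b h1 h2 h3 h4 => ?_⟩
  have hax := h1.ne'
  have hbx := h2.ne'
  have key := hc x a b
  by_cases hx : x = u <;> by_cases ha : a = u <;> by_cases hb : b = u <;>
    cases hcx : c x <;> cases hca : c a <;> cases hcb : c b <;> simp_all

/-- The upper bound 3 for the chromatic number need not be demanded: it follows from a good
2-colouring of any single vertex-deleted subgraph. -/
theorem isDefectiveCritical_iff [Nonempty V] :
    G.IsDefectiveCritical 3 1 ↔
      (∀ c, ¬ G.IsGoodOn (fun _ => True) c) ∧ ∀ u, ∃ c, G.IsGoodOn (· ≠ u) c := by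
  have h2 : G.defectiveChromaticNumber 1 < 3 ↔ _ :=
    (G.defectiveChromaticNumber_lt_succ_iff (m := 2)).trans G.defectiveColorable_two_iff
  have h3 : G.defectiveChromaticNumber 1 < 4 ↔ _ := G.defectiveChromaticNumber_lt_succ_iff (m := 3)
  have hu : ∀ u : V, (G.induce ({u}ᶜ : Set V)).defectiveChromaticNumber 1 < 3 ↔ _ := fun u =>
    ((G.induce ({u}ᶜ : Set V)).defectiveChromaticNumber_lt_succ_iff (m := 2)).trans
      (G.defectiveColorable_two_induce_iff u)
  have key : G.defectiveChromaticNumber 1 = 3 ↔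
      ¬ G.defectiveChromaticNumber 1 < 3 ∧ G.defectiveChromaticNumber 1 < 4 := by
    rw [not_lt, show (4 : ℕ∞) = 3 + 1 from rfl, ENat.lt_add_one_iff (by decide), le_antisymm_iff,
      and_comm]
  rw [IsDefectiveCritical, Nat.cast_ofNat, key, h2, h3]
  simp only [hu, not_exists]
  constructor
  · exact fun h => ⟨h.1.1, h.2⟩
  · intro h
    obtain ⟨u⟩ := ‹Nonempty V›
    obtain ⟨c, hc⟩ := h.2 u
    exact ⟨⟨h.1, G.defectiveColorable_three_of_isGoodOn hc⟩, h.2⟩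

theorem IsGoodOn.comp_iso {W : Type*} {G : SimpleGraph V} {H : SimpleGraph W} (e : G ≃g H)
    {P : W → Prop} {c : W → Bool} (hc : H.IsGoodOn P c) :
    G.IsGoodOn (fun x => P (e x)) (fun x => c (e x)) :=
  fun x a b hx ha hb h1 h2 h3 h4 =>
    e.injective (hc (e x) (e a) (e b) hx ha hb (e.map_rel_iff.2 h1) (e.map_rel_iff.2 h2) h3 h4)

theorem cliqueFree_three_iff :
    G.CliqueFree 3 ↔ ∀ a b c, G.Adj a b → G.Adj b c → ¬ G.Adj a c := by
  classical
  constructor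
  · exact fun h a b c h1 h2 h3 => h {a, b, c} (is3Clique_triple_iff.2 ⟨h1, h3, h2⟩)
  · rintro h s hs
    obtain ⟨a, b, c, h1, h2, h3, -⟩ := is3Clique_iff.1 hs
    exact h a b c h1 h3 h2

end Colourings

/-! ### Colouring graphs of maximum degree three -/

section MaximumCut

variable {V : Type*} [Fintype V] (G : SimpleGraph V)

/-- Applied to the change in monochromatic pairs when `x` is recoloured: it lives on row and column
`x`, which meet only in the zero diagonal entry. -/
theorem sum_sum_eq_two_mul [DecidableEq V] (h : V → V → ℤ) (x : V) (symm : ∀ y z, h y z = h z y)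
    (diag : h x x = 0) (supp : ∀ y z, y ≠ x → z ≠ x → h y z = 0) :
    ∑ y, ∑ z, h y z = 2 * ∑ z, h x z := by
  have h1 : ∀ y, ∑ z, h y z = (if y = x then ∑ z, h x z else 0) + h x y := by
    intro y
    by_cases hy : y = x
    · subst hy; simp [diag]
    · rw [if_neg hy, zero_add, Finset.sum_eq_single x (fun z _ hz => supp y z hy hz) (by simp),
        symm]
  rw [Finset.sum_congr rfl fun y _ => h1 y, Finset.sum_add_distrib]
  simp
  ring

/-- A graph of maximum degree at most three has a `1`-defective `2`-colouring. -/
theorem exists_isGoodOn_of_degree_le_three [DecidableRel G.Adj] (hG : ∀ x, G.degree x ≤ 3) :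
    ∃ c, G.IsGoodOn (fun _ => True) c := by
  classical
  let w : (V → Bool) → V → V → ℤ := fun c y z => if G.Adj y z ∧ c y = c z then 1 else 0
  -- Choose a colouring with fewest monochromatic edges, that is, a maximum cut.
  obtain ⟨c, -, hc⟩ := Finset.exists_min_image (Finset.univ : Finset (V → Bool))
    (fun c => ∑ y, ∑ z, w c y z) Finset.univ_nonempty
  refine ⟨c, fun x a b _ _ _ hxa hxb ha hb => ?_⟩
  by_contra hab
  let c' := Function.update c x (!c x)
  have hx : c' x = !c x := Function.update_self ..
  have hne : ∀ y, y ≠ x → c' y = c y := fun y hy => Function.update_of_ne hy ..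
  have hmin := hc c' (Finset.mem_univ _)
  have e1 := sum_sum_eq_two_mul (fun y z => w c' y z - w c y z) x
    (fun y z => by simp only [w, G.adj_comm y z, eq_comm (a := c' y), eq_comm (a := c y)])
    (by simp [w]) (fun y z hy hz => by simp only [w, hne y hy, hne z hz, sub_self])
  have e2 : ∑ z, (w c' x z - w c x z) =
      ∑ z, ((if G.Adj x z then (1 : ℤ) else 0) - 2 * w c x z) := by
    refine Finset.sum_congr rfl fun z _ => ?_
    by_cases hz : G.Adj x z
    · have := hne z hz.ne'
      simp only [w, hz, hx, this, true_and, if_true]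
      cases c x <;> cases c z <;> simp
    · simp [w, hz]
  have e3 : ∑ z, (if G.Adj x z then (1 : ℤ) else 0) = G.degree x := by
    rw [Finset.sum_boole, ← card_neighborFinset_eq_degree]
    congr 2
    ext z
    simp
  have e4 : 2 ≤ ∑ z, w c x z := by
    calc (2 : ℤ) = ∑ z ∈ {a, b}, w c x z := by
          rw [Finset.sum_pair hab]; simp [w, hxa, hxb, ha, hb]
      _ ≤ _ := Finset.sum_le_sum_of_subset_of_nonneg (Finset.subset_univ _)
          fun z _ _ => by dsimp only [w]; split_ifs <;> norm_num
  rw [e2, Finset.sum_sub_distrib, e3, ← Finset.mul_sum] at e1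
  simp only [Finset.sum_sub_distrib] at e1
  -- Recolouring `x` changes the sum by `2 * (deg x - 2 * m)`, where `m ≥ 2` counts its neighbours
  -- of equal colour; this is negative, against minimality.
  have := hG x
  have : (G.degree x : ℤ) ≤ 3 := by exact_mod_cast this
  linarith

end MaximumCut

end SimpleGraph

namespace DefectiveSearch

/-! ### The graph found by the search -/

open SimpleGraph

/-- The graph that the search finds. -/
def foundGraph : SimpleGraph (Fin 10) where
  Adj i j := entry foundMatrix i j = true
  symm := ⟨by decide +kernel⟩
  loopless := ⟨by decide +kernel⟩

instance : DecidableRel foundGraph.Adj := fun _ _ => inferInstanceAs (Decidable (_ = true))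

theorem foundGraph_adj {i j : Fin 10} :
    foundGraph.Adj i j ↔ foundMatrix.testBit (11 * (i : ℕ) + j) = true := by
  rw [← entry_eq]; rfl

theorem foundGraph_cliqueFree : foundGraph.CliqueFree 3 := by
  rw [cliqueFree_three_iff]
  decide +kernel

/-- The finite check covers the colourings with vertex 9 in colour 0; adding the colour of 9 modulo
2 reduces any colouring to one of these. -/
theorem foundGraph_not_isGoodOn (c : Fin 10 → Bool) : ¬ foundGraph.IsGoodOn (fun _ => True) c := by
  intro hc
  have bad : ∀ M ∈ colourMasks, sparse (Nat.land foundMatrix M) = false := by decide +kernel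
  let d : ℕ → Bool := fun k => if h : k < 10 then c ⟨k, h⟩ else true
  have hd : ∀ {k} (h : k < 10), d k = c ⟨k, h⟩ := fun h => dif_pos h
  let n := packBits (fun k => d k ^^ d 9) 9
  have hn := bad (colourMask n) (mem_colourMasks.2 ⟨n, packBits_lt _ 9, rfl⟩)
  refine Bool.false_ne_true (hn.symm.trans ((sparse_and_colourMask (packBits_nine_lt _) _).2 ?_))
  intro i hi a ha b hb h1 h2 h3 h4
  rw [testBit_xor_code d ha, testBit_xor_code d hi, Bool.xor_left_inj, hd ha, hd hi] at h2
  rw [testBit_xor_code d hb, testBit_xor_code d hi, Bool.xor_left_inj, hd hb, hd hi] at h4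
  exact congrArg Fin.val (hc ⟨i, hi⟩ ⟨a, ha⟩ ⟨b, hb⟩ trivial trivial trivial
    (foundGraph_adj.2 h1) (foundGraph_adj.2 h3) h2 h4)

theorem foundGraph_exists_isGoodOn (w : Fin 10) : ∃ c, foundGraph.IsGoodOn (· ≠ w) c := by
  have good : ∀ w : Fin 10, deletionBad foundMatrix w = false := by decide +kernel
  have hw := good w
  rw [deletionBad, anyIn_eq, keep_eq, Bool.not_eq_false', List.any_eq_true] at hw
  obtain ⟨M, hM, hs⟩ := hw
  obtain ⟨n, hn, rfl⟩ := mem_colourMasks.1 (List.mem_of_mem_filter hM)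
  have e : Nat.land (Nat.land foundMatrix (colourMask n)) (avoidMask w) =
      Nat.land (foundMatrix &&& avoidMask w) (colourMask n) := Nat.and_right_comm _ _ _
  rw [e, sparse_and_colourMask (hn.trans (by norm_num))] at hs
  have av : ∀ i j : Fin 10, foundGraph.Adj i j → i ≠ w → j ≠ w →
      (foundMatrix &&& avoidMask w).testBit (11 * i + j) = true := by
    intro i j hij hi hj
    rw [Nat.testBit_and, foundGraph_adj.1 hij, avoidMask, testBit_packMatrix _ i.2 j.2, conj_eq]
    have ne : ∀ {k : Fin 10}, k ≠ w → Nat.beq k w = false := fun hk =>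
      Bool.eq_false_iff.2 fun h => hk (Fin.ext (Nat.eq_of_beq_eq_true h))
    simp only [ne hi, ne hj, Bool.not_false, Bool.and_self]
  exact ⟨fun i => n.testBit i, fun i a b hi ha hb h1 h2 h3 h4 =>
    Fin.ext (hs i i.2 a a.2 b b.2 (av i a h1 hi ha) h3 (av i b h2 hi hb) h4)⟩

/-- The numbering of the vertices of `graphG5` in the matrix that the search finds. -/
def numbering : Fin 10 ≃ Fin 10 where
  toFun := ![0, 6, 1, 2, 3, 4, 5, 9, 8, 7]
  invFun := ![0, 2, 3, 4, 5, 6, 1, 9, 8, 7]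
  left_inv := by decide
  right_inv := by decide

def graphG5Iso : graphG5 ≃g foundGraph where
  toEquiv := numbering
  map_rel_iff' := by
    unfold graphG5
    simp only [fromRel_adj]
    decide +kernel

/-! ### Numbering an abstract critical graph -/

variable {V : Type*} {G : SimpleGraph V}

/-- A vertex of maximum degree and a path outside its closed neighbourhood. -/
theorem exists_path_of_not_isGoodOn (hG : G.CliqueFree 3)
    (hc : ∀ c, ¬ G.IsGoodOn (fun _ => True) c) (v : V) :
    ∃ x a b, a ≠ b ∧ x ≠ v ∧ a ≠ v ∧ b ≠ v ∧ ¬ G.Adj v x ∧ ¬ G.Adj v a ∧ ¬ G.Adj v b ∧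
      G.Adj x a ∧ G.Adj x b := by
  classical
  rw [cliqueFree_three_iff] at hG
  -- The neighbourhood of `v` against its complement. Since the neighbourhood is independent, the
  -- defect lies in the complement, where `v` has no neighbours.
  have h := hc fun y => decide (G.Adj v y)
  simp only [IsGoodOn, not_forall, decide_eq_decide] at h
  obtain ⟨x, a, b, -, -, -, hxa, hxb, ha, hb, hab⟩ := h
  have hvx : ¬ G.Adj v x := fun hx => hG v x a hx hxa (ha.2 hx)
  have hva := mt ha.1 hvx
  have hvb := mt hb.1 hvx
  exact ⟨x, a, b, hab, fun e => hva (e ▸ hxa), fun e => hvx (e ▸ hxa.symm),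
    fun e => hvx (e ▸ hxb.symm), hvx, hva, hvb, hxa, hxb⟩

/-- The adjacency matrix of `G` with respect to a numbering of the vertices. -/
noncomputable def pulledBack (G : SimpleGraph V) (f : ℕ → V) (i j : ℕ) : Bool :=
  open Classical in decide (i < 10 ∧ j < 10 ∧ G.Adj (f i) (f j))

theorem pulledBack_iff {f : ℕ → V} {i j : ℕ} :
    pulledBack G f i j = true ↔ i < 10 ∧ j < 10 ∧ G.Adj (f i) (f j) := by
  simp [pulledBack]

theorem pulledBack_admissible [Fintype V] [DecidableRel G.Adj] (hG : G.CliqueFree 3)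
    (hc : ∀ c, ¬ G.IsGoodOn (fun _ => True) c) (hu : ∀ u, ∃ c, G.IsGoodOn (· ≠ u) c)
    (e : Fin 10 ≃ V) {f : ℕ → V} (hf : ∀ i : Fin 10, f i = e i)
    (hsort : ∀ i, 1 ≤ i → i < G.maxDegree →
      packBits (pulledBack G f (i + 1)) 10 >>> (G.maxDegree + 1) ≤
        packBits (pulledBack G f i) 10 >>> (G.maxDegree + 1)) :
    Admissible G.maxDegree (pulledBack G f) := by
  classical
  rw [cliqueFree_three_iff] at hG
  have inj : ∀ {i j}, i < 10 → j < 10 → f i = f j → i = j := fun {i j} hi hj h =>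
    congrArg Fin.val (e.injective ((hf ⟨i, hi⟩).symm.trans (h.trans (hf ⟨j, hj⟩))))
  have hfs : ∀ x, f (e.symm x) = x := fun x => by rw [hf, e.apply_symm_apply]
  refine ⟨fun i j h => ?_, fun i j h => (pulledBack_iff.1 h).1, fun i j k h1 h2 => ?_,
    fun i s hs => ?_, hsort, fun c hcol => hc (fun x => c (e.symm x)) ?_, fun w hw => ?_⟩
  · rw [pulledBack_iff] at h ⊢
    exact ⟨h.2.1, h.1, h.2.2.symm⟩
  · rw [pulledBack_iff] at h1 h2
    rw [Bool.eq_false_iff, Ne, pulledBack_iff]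
    exact fun h3 => hG _ _ _ h1.2.2 h2.2.2 h3.2.2
  · simp only [pulledBack_iff] at hs
    rw [← Finset.card_image_of_injOn (s := s) (f := f) fun a ha b hb h =>
      inj (hs a ha).2.1 (hs b hb).2.1 h]
    refine le_trans (Finset.card_le_card fun y hy => ?_) (G.degree_le_maxDegree (f i))
    obtain ⟨j, hj, rfl⟩ := Finset.mem_image.1 hy
    exact (G.mem_neighborFinset _ _).2 (hs j hj).2.2
  · intro x a b _ _ _ h1 h2 h3 h4
    have adj : ∀ {y z}, G.Adj y z → pulledBack G f (e.symm y) (e.symm z) = true := fun h =>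
      pulledBack_iff.2 ⟨Fin.is_lt _, Fin.is_lt _, by rwa [hfs, hfs]⟩
    exact e.symm.injective (Fin.ext (hcol _ _ _ trivial trivial trivial (adj h1) (adj h2) h3 h4))
  · obtain ⟨c, hcol⟩ := hu (f w)
    refine ⟨fun i => c (f i), fun i a b hi ha hb h1 h2 h3 h4 => ?_⟩
    rw [pulledBack_iff] at h1 h2
    exact inj h1.2.1 h2.2.1 (hcol _ _ _ (fun h => hi (inj h1.1 hw h))
      (fun h => ha (inj h1.2.1 hw h)) (fun h => hb (inj h2.2.1 hw h)) h1.2.2 h2.2.2 h3 h4)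

/-- A numbering that starts with `v`, continues with its neighbours, sorted by the codes of their
adjacencies to the later vertices, and ends with a given path. -/
theorem exists_numbering [Fintype V] [DecidableRel G.Adj] (hV : Fintype.card V = 10) {v x a b : V}
    (hab : a ≠ b) (hxv : x ≠ v) (hav : a ≠ v) (hbv : b ≠ v) (hvx : ¬ G.Adj v x)
    (hva : ¬ G.Adj v a) (hvb : ¬ G.Adj v b) (hxa : G.Adj x a) (hxb : G.Adj x b) :
    G.degree v ≤ 6 ∧ ∃ (e : Fin 10 ≃ V) (f : ℕ → V), (∀ i : Fin 10, f i = e i) ∧ f 0 = v ∧ f 7 = b ∧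
      f 8 = a ∧ f 9 = x ∧ (∀ i, 1 ≤ i → i ≤ G.degree v → G.Adj v (f i)) ∧
      (∀ i, G.degree v < i → i < 10 → ¬ G.Adj v (f i)) ∧
      ∀ i, 1 ≤ i → i < G.degree v →
        packBits (pulledBack G f (i + 1)) 10 >>> (G.degree v + 1) ≤
          packBits (pulledBack G f i) 10 >>> (G.degree v + 1) := by
  classical
  set N := G.neighborFinset v with hN
  set D := G.degree v with hD
  have hND : N.card = D := G.card_neighborFinset_eq_degree v
  set S : Finset V := {x, a, b} with hS
  have hScard : S.card = 3 := Finset.card_eq_three.2 ⟨x, a, b, hxa.ne, hxb.ne, hab, rfl⟩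
  have hvN : v ∉ N := by simp [hN]
  have hSN : Disjoint (insert v N) S := by
    rw [Finset.disjoint_right]
    simp [hS, hN, hxv, hav, hbv, hvx, hva, hvb]
  set Q := (insert v N ∪ S)ᶜ with hQ
  -- The closed neighbourhood of `v` and the path are disjoint and have `D + 1` and 3 vertices,
  -- whence `D ≤ 6`.
  have hQcard : Q.card + (D + 4) = 10 := by
    have h1 := Finset.card_add_card_compl (insert v N ∪ S)
    rw [Finset.card_union_of_disjoint hSN, Finset.card_insert_of_notMem hvN, hND, hScard, hV, ← hQ] at h1
    omega
  refine ⟨by omega, ?_⟩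
  set lB := Q.toList ++ [b, a, x] with hlB
  have hlBlen : lB.length = 9 - D := by simp [hlB]; omega
  -- The code reads only columns after `D`, filled by `lB`, so it does not depend on the order still
  -- to be chosen for the neighbours.
  let code : V → ℕ := fun y =>
    packBits (fun j => decide (D < j ∧ j < 10 ∧ G.Adj y (lB.getD (j - (D + 1)) v))) 10 >>> (D + 1)
  set lA := N.toList.mergeSort (fun y z => decide (code z ≤ code y)) with hlA
  have hlAlen : lA.length = D := by simp [hlA, hND]
  have hsorted : lA.Pairwise fun y z => code z ≤ code y := by
    have := List.pairwise_mergeSort (le := fun y z => decide (code z ≤ code y))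
      (by simp only [decide_eq_true_eq]; exact fun _ _ _ h1 h2 => h2.trans h1)
      (by simp only [Bool.or_eq_true, decide_eq_true_eq]; exact fun _ _ => le_total _ _) N.toList
    simpa using this
  have hmA : ∀ y ∈ lA, G.Adj v y := fun y hy => by
    rwa [hlA, List.mem_mergeSort, Finset.mem_toList, hN, mem_neighborFinset] at hy
  set l := v :: (lA ++ lB) with hl
  have hllen : l.length = 10 := by simp [hl, hlAlen, hlBlen]; omega
  have hmem : ∀ y, y ∈ l := by
    intro y
    by_cases h : y ∈ insert v N ∪ S
    · simp only [hl, hlA, hlB, List.mem_cons, List.mem_append, List.mem_mergeSort,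
        Finset.mem_toList]
      simp only [hS, Finset.mem_union, Finset.mem_insert, Finset.mem_singleton] at h
      simp only [List.not_mem_nil, or_false]
      tauto
    · have hy : y ∈ Q := Finset.mem_compl.2 h
      simp [hl, hlB, hy]
  have hfsurj : Function.Surjective fun i : Fin 10 => l.get (i.cast hllen.symm) := by
    intro y
    obtain ⟨n, hn⟩ := List.mem_iff_get.1 (hmem y)
    exact ⟨n.cast hllen, by simpa using hn⟩
  let e : Fin 10 ≃ V := Equiv.ofBijective _
    ((Fintype.bijective_iff_surjective_and_card _).2 ⟨hfsurj, by simp [hV]⟩)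
  let f : ℕ → V := fun i => l.getD i v
  have fA : ∀ i (h1 : 1 ≤ i) (h2 : i ≤ D), f i = lA[i - 1]'(by omega) := by
    intro i h1 h2
    obtain ⟨i, rfl⟩ : ∃ k, i = k + 1 := ⟨i - 1, by omega⟩
    simp only [f, hl, List.getD_cons_succ, Nat.add_sub_cancel]
    rw [List.getD_append _ _ _ _ (by omega), List.getD_eq_getElem]
  have fB : ∀ i, D < i → f i = lB.getD (i - (D + 1)) v := by
    intro i h1
    obtain ⟨i, rfl⟩ : ∃ k, i = k + 1 := ⟨i - 1, by omega⟩
    simp only [f, hl, List.getD_cons_succ]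
    rw [List.getD_append_right _ _ _ _ (by omega), hlAlen]
    congr 1
    omega
  -- `Q` has `6 - D` elements and occupies the positions `D + 1, …, 6`.
  have fS : ∀ i, i < 3 → f (7 + i) = [b, a, x].getD i v := by
    intro i hi
    have : Q.toList.length = Q.card := Finset.length_toList Q
    rw [fB _ (by omega), hlB, List.getD_append_right _ _ _ _ (by omega)]
    congr 1
    omega
  have fcode : ∀ i, i < 10 → packBits (pulledBack G f i) 10 >>> (D + 1) = code (f i) := by
    intro i hi
    refine Nat.eq_of_testBit_eq fun j => ?_
    simp only [code, Nat.testBit_shiftRight, testBit_packBits, pulledBack]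
    rw [fB (D + 1 + j) (by omega)]
    congr 1
    rw [decide_eq_decide]
    have : D < D + 1 + j := by omega
    tauto
  refine ⟨e, f, fun i => ?_, rfl, fS 0 (by norm_num), fS 1 (by norm_num), fS 2 (by norm_num),
    fun i h1 h2 => ?_, fun i h1 h2 => ?_, fun i h1 h2 => ?_⟩
  · change l.getD i v = l.get _
    rw [List.getD_eq_getElem _ _ (by omega)]
    rfl
  · rw [fA i h1 h2]
    exact hmA _ (List.getElem_mem _)
  · have hmemB : f i ∈ lB := by
      rw [fB i h1, List.getD_eq_getElem _ _ (by omega)]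
      exact List.getElem_mem _
    intro hadj
    simp only [hlB, List.mem_append, Finset.mem_toList, hQ, Finset.mem_compl, Finset.mem_union,
      Finset.mem_insert, hN, mem_neighborFinset, hadj, List.mem_cons, List.not_mem_nil] at hmemB
    rcases hmemB with h | h | h | h | h
    · simp at h
    all_goals first | exact h | (rw [h] at hadj; contradiction)
  · rw [fcode i (by omega), fcode (i + 1) (by omega), fA i h1 h2.le, fA (i + 1) (by omega) h2]
    exact List.pairwise_iff_getElem.1 hsorted _ _ _ _ (by omega)

theorem nonempty_iso_foundGraph [Fintype V] (hV : Fintype.card V = 10) (hG : G.CliqueFree 3)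
    (hc : ∀ c, ¬ G.IsGoodOn (fun _ => True) c) (hu : ∀ u, ∃ c, G.IsGoodOn (· ≠ u) c) :
    Nonempty (G ≃g foundGraph) := by
  classical
  have : Nonempty V := Fintype.card_pos_iff.1 (by omega)
  obtain ⟨v, hv⟩ := G.exists_maximal_degree_vertex
  obtain ⟨x, a, b, hab, hxv, hav, hbv, hvx, hva, hvb, hxa, hxb⟩ :=
    exists_path_of_not_isGoodOn hG hc v
  obtain ⟨hD6, e, f, hf, f0, f7, f8, f9, hA, hB, hsort⟩ :=
    exists_numbering hV hab hxv hav hbv hvx hva hvb hxa hxb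
  rw [← hv] at hD6 hA hB hsort
  have hD4 : 4 ≤ G.maxDegree := by
    by_contra! hlt
    obtain ⟨c, hcol⟩ := G.exists_isGoodOn_of_degree_le_three fun y =>
      (G.degree_le_maxDegree y).trans (Nat.lt_succ_iff.1 hlt)
    exact hc c hcol
  have adm := pulledBack_admissible hG hc hu e hf hsort
  have tri := G.cliqueFree_three_iff.1 hG
  have fixed : ∀ i < 10, ∀ j < 10, isFixedEdge G.maxDegree i j = true →
      pulledBack G f i j = true := by
    intro i hi j hj h
    rw [pulledBack_iff]
    refine ⟨hi, hj, ?_⟩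
    simp only [isFixedEdge, Bool.or_eq_true, Bool.and_eq_true, beq_iff_eq, decide_eq_true_iff] at h
    rcases h with ((⟨⟨rfl, h1⟩, h2⟩ | ⟨⟨rfl, h1⟩, h2⟩) | ⟨rfl, rfl | rfl⟩) | ⟨rfl, rfl | rfl⟩
    · rw [f0]; exact hA j h1 h2
    · rw [f0]; exact (hA i h1 h2).symm
    · rw [f9, f7]; exact hxb
    · rw [f9, f8]; exact hxa
    · rw [f9, f7]; exact hxb.symm
    · rw [f9, f8]; exact hxa.symm
  have free : ∀ i < 10, ∀ j < 10, pulledBack G f i j = true →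
      (isFixedEdge G.maxDegree i j || isFreePair G.maxDegree i j) = true := by
    intro i hi j hj h
    obtain ⟨-, -, h⟩ := pulledBack_iff.1 h
    have hij : i ≠ j := fun hij => h.ne (by rw [hij])
    have h0 : ∀ j < 10, G.Adj (f 0) (f j) → 0 < j ∧ j ≤ G.maxDegree := by
      intro j hj h
      rw [f0] at h
      refine ⟨Nat.pos_of_ne_zero fun h' => ?_, ?_⟩
      · rw [h', f0] at h; exact h.ne rfl
      · by_contra! hlt; exact hB j hlt hj h
    -- Two adjacent neighbours of `v` would form a triangle with it.
    have hAA : ¬ (1 ≤ i ∧ i ≤ G.maxDegree ∧ 1 ≤ j ∧ j ≤ G.maxDegree) := fun ⟨h1, h2, h3, h4⟩ =>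
      tri _ _ _ (hA i h1 h2) h (hA j h3 h4)
    have h78 : ¬ G.Adj (f 7) (f 8) := fun h' => by
      rw [f7, f8] at h'; exact tri _ _ _ hxb h' hxa
    have hi0 : i ≠ 0 ∨ 0 < j ∧ j ≤ G.maxDegree :=
      Classical.or_iff_not_imp_left.2 fun h' => h0 j hj (by rwa [not_not.1 h'] at h)
    have hj0 : j ≠ 0 ∨ 0 < i ∧ i ≤ G.maxDegree :=
      Classical.or_iff_not_imp_left.2 fun h' => h0 i hi (by rw [not_not.1 h'] at h; exact h.symm)
    have hi7 : ¬ (i = 7 ∧ j = 8) := by rintro ⟨rfl, rfl⟩; exact h78 h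
    have hi8 : ¬ (i = 8 ∧ j = 7) := by rintro ⟨rfl, rfl⟩; exact h78 h.symm
    simp only [isFixedEdge, isFreePair, Bool.or_eq_true, Bool.and_eq_true, beq_iff_eq,
      decide_eq_true_iff, Bool.not_eq_true', beq_eq_false_iff_ne, Bool.and_eq_false_iff,
      decide_eq_false_iff_not]
    omega
  have hs : searchFrom G.maxDegree foundMatrix = true := by
    have : G.maxDegree = 4 ∨ G.maxDegree = 5 ∨ G.maxDegree = 6 := by omega
    rcases this with h | h | h <;> rw [h]
    exacts [searchFrom_four, searchFrom_five, searchFrom_six]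
  have packed := searchFrom_sound (by omega) adm fixed free hs
  refine ⟨(RelIso.symm ⟨e, fun {i j} => ?_⟩ : G ≃g foundGraph)⟩
  rw [foundGraph_adj, ← packed i i.2 j j.2, pulledBack_iff, hf, hf]
  exact ⟨fun h => ⟨i.2, j.2, h⟩, fun h => h.2.2⟩

end DefectiveSearch

open DefectiveSearch in
theorem mainTheorem3 {V : Type*} [Fintype V] (hV : Fintype.card V = 10) (G : SimpleGraph V) :
    (G.CliqueFree 3 ∧ G.IsDefectiveCritical 3 1) ↔ Nonempty (G ≃g SimpleGraph.graphG5) := by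
  have : Nonempty V := Fintype.card_pos_iff.1 (by omega)
  rw [G.isDefectiveCritical_iff]
  constructor
  · rintro ⟨hG, hc, hu⟩
    obtain ⟨e⟩ := nonempty_iso_foundGraph hV hG hc hu
    exact ⟨e.trans graphG5Iso.symm⟩
  · rintro ⟨e'⟩
    -- Both properties are invariant under isomorphism, so they are transported from `foundGraph`.
    have e : G ≃g foundGraph := e'.trans graphG5Iso
    refine ⟨?_, fun c hc => ?_, fun u => ?_⟩
    · rw [SimpleGraph.cliqueFree_three_iff]
      intro a b c h1 h2 h3
      exact foundGraph.cliqueFree_three_iff.1 foundGraph_cliqueFree (e a) (e b) (e c)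
        (e.map_rel_iff.2 h1) (e.map_rel_iff.2 h2) (e.map_rel_iff.2 h3)
    · exact foundGraph_not_isGoodOn _ (hc.comp_iso e.symm)
    · obtain ⟨c, hc⟩ := foundGraph_exists_isGoodOn (e u)
      refine ⟨fun x => c (e x), fun x a b hx ha hb => ?_⟩
      exact hc.comp_iso e x a b (e.injective.ne hx) (e.injective.ne ha) (e.injective.ne hb)
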